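/- Let $D=(V,A)$ be a finite digraph without loops (and without parallel arcs) that is semicomplete, i.e. for any two distinct vertices $x,y$ at least one of $xy,yx$ is an arc. Definitions. $D$ is a comparability digraph if $V$ has a strict total order $\prec$ such that for all $x\prec y\prec z$: $xy,yz\in A$ imply $xz\in A$, and $zy,yx\in A$ imply $zx\in A$. Let $Z_D=\{(x,y): xy\in A \text{ or } yx\in A\}$. For $(x,y),(x',y')\in Z_D$ write $(x,y)\,\Gamma\,(x',y')$ if one of the following holds: (a) $x=x'$ and $y=y'$; (b) $x=x'$, $y\ne y'$, and either $yx,x'y'\in A$ and $yy'\notin A$, or $y'x',xy\in A$ and $y'y\notin A$; (c) $y=y'$, $x\neq x'$, and either $xy,y'x'\in A$ and $xx'\notin A$, or $x'y',yx\in A$ and $x'x\notin A$. The transitive closure $\Gamma^*$ of $\Gamma$ is an equivalence relation on $Z_D$; its equivalence classes are the implication classes of $D$. For a set $I$ of pairs, $I^{-1}=\{(y,x):(x,y)\in I\}$; and $I$ contains a circuit if there are $k\ge 1$ and vertices $x_1,\dots,x_k$ with $(x_1,x_2),(x_2,x_3),\dots,(x_{k-1},x_k),(x_k,x_1)\in I$.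 Pairs $(x,y),(x,z)\in Z_D$ are knotted if there are pairs $(x,y)=(x,y_0)\,\Gamma\,(x,y_1)\,\Gamma\cdots\Gamma\,(x,y_k)=(x,z)$ in $Z_D$, all with first vertex $x$. For each $x$ this equivalence relation partitions the neighbourhood $N(x)=\{y:(x,y)\in Z_D\}$ into classes $x^1,\dots,x^{\ell_x}$. The knotting graph $\tilde K_D$ has as vertices all $x^{\alpha}$ ($x\in V$, $1\le\alpha\le \ell_x$), where classes of different vertices $x$ count as different, and $x^\alpha y^\beta$ is an edge whenever $x\in y^\beta$ and $y\in x^\alpha$. A closed knotting walk of length $p\geq 1$ is a sequence of vertices $x_0,x_1,\dots,x_p=x_0$ such that $(x_i,x_{i-1})$ and $(x_i,x_{i+1})$ are knotted for all $0<i<p$ and also $(x_0,x_{p-1})$ and $(x_0,x_1)$ are knotted; it is odd if $p$ is odd. Theorem. The following statements are equivalent: 1. $D$ is a comparability digraph; 2. the knotting graph $\tilde K_D$ is bipartite; 3. $D$ contains no odd closed knotting walk; 4. $I\neq I^{-1}$ for every implication class $I$ of $D$; 5. no implication class of $D$ contains a circuit. -/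

import Mathlib

/-! Digraphs are Mathlib's `Digraph V`; `D.Adj x y` says that `xy` is an arc of `D`. -/

namespace Digraph

variable {V : Type*}

/-- No vertex has an arc to itself. -/
def IsLoopless (D : Digraph V) : Prop := ∀ x, ¬ D.Adj x x

/-- Any two distinct vertices are joined by at least one arc. -/
def IsSemicomplete (D : Digraph V) : Prop := ∀ x y, x ≠ y → D.Adj x y ∨ D.Adj y x

/-- The strict total order `r` is a comparability ordering of `D`. -/
structure IsComparabilityOrdering (D : Digraph V) (r : V → V → Prop) : Prop where
  strictTotal : IsStrictTotalOrder V r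
  forward : ∀ x y z, r x y → r y z → D.Adj x y → D.Adj y z → D.Adj x z
  backward : ∀ x y z, r x y → r y z → D.Adj z y → D.Adj y x → D.Adj z x

/-- `D` is a comparability digraph. -/
def IsComparability (D : Digraph V) : Prop :=
  ∃ r : V → V → Prop, D.IsComparabilityOrdering r

/-- The set `Z_D` of ordered pairs of adjacent vertices. -/
def pairs (D : Digraph V) : Set (V × V) := {p | D.Adj p.1 p.2 ∨ D.Adj p.2 p.1}

/-- The relation `Γ` on `Z_D`: `p` directly forces `q`. -/
def DirectlyForces (D : Digraph V) (p q : V × V) : Prop :=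
  p ∈ D.pairs ∧ q ∈ D.pairs ∧
    ((p.1 = q.1 ∧ p.2 = q.2) ∨
     (p.1 = q.1 ∧ p.2 ≠ q.2 ∧
        ((D.Adj p.2 p.1 ∧ D.Adj q.1 q.2 ∧ ¬ D.Adj p.2 q.2) ∨
         (D.Adj q.2 q.1 ∧ D.Adj p.1 p.2 ∧ ¬ D.Adj q.2 p.2))) ∨
     (p.2 = q.2 ∧ p.1 ≠ q.1 ∧
        ((D.Adj p.1 p.2 ∧ D.Adj q.2 q.1 ∧ ¬ D.Adj p.1 q.1) ∨
         (D.Adj q.1 q.2 ∧ D.Adj p.2 p.1 ∧ ¬ D.Adj q.1 p.1))))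

/-- The transitive closure `Γ*` of `Γ`. -/
def Forces (D : Digraph V) : V × V → V × V → Prop := Relation.TransGen D.DirectlyForces

/-- The set of implication classes, i.e. of equivalence classes of `Z_D` under `Γ*`. -/
def implicationClasses (D : Digraph V) : Set (Set (V × V)) :=
  {I | ∃ p ∈ D.pairs, I = {q | D.Forces p q}}

/-- The pairs `(x, y)` and `(x, z)` at `x` are knotted: they are joined by a chain of pairs
at `x`, each of which directly forces the next one. (In particular both lie in `Z_D`.) -/
def Knotted (D : Digraph V) (x : V) : V → V → Prop :=
  Relation.TransGen fun y z => D.DirectlyForces (x, y) (x, z)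

/-- The vertices of the knotting graph: a partial copy of `x` is the vertex `x` together with one
of the classes into which knottedness divides the neighbourhood of `x`. -/
def PartialCopy (D : Digraph V) : Type _ :=
  {c : V × Set V // ∃ y, (c.1, y) ∈ D.pairs ∧ c.2 = {z | D.Knotted c.1 y z}}

theorem mem_pairs_of_knotted {D : Digraph V} {x y z : V} (h : D.Knotted x y z) :
    (x, z) ∈ D.pairs := by
  cases h with
  | single h => exact h.2.1
  | tail _ h => exact h.2.1

/-- The knotting graph of a loopless digraph: partial copies of `x` and `y` are adjacent when each
of the vertices `x`, `y` belongs to the class of the other. -/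
def knottingGraph (D : Digraph V) (hD : D.IsLoopless) : SimpleGraph D.PartialCopy where
  Adj u v := v.1.1 ∈ u.1.2 ∧ u.1.1 ∈ v.1.2
  symm := ⟨fun _ _ h => ⟨h.2, h.1⟩⟩
  loopless := ⟨by
    rintro ⟨⟨x, s⟩, y, _, hs⟩ ⟨h, -⟩
    have hs' : s = {z | D.Knotted x y z} := hs
    subst hs'
    exact (mem_pairs_of_knotted h).elim (hD x) (hD x)⟩

/-- The sequence `x 0, x 1, …, x p` is a knotting walk. -/
def IsKnottingWalk (D : Digraph V) (p : ℕ) (x : ℕ → V) : Prop :=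
  ∀ i, i + 1 < p → D.Knotted (x (i + 1)) (x i) (x (i + 2))

/-- The knotting walk `x 0, x 1, …, x p = x 0` (of length `p`) is closed: the walk returns to its
first vertex and the knotting condition also holds there, so that it corresponds to a
closed walk of the knotting graph. -/
def IsClosedKnottingWalk (D : Digraph V) (p : ℕ) (x : ℕ → V) : Prop :=
  D.IsKnottingWalk p x ∧ x p = x 0 ∧ D.Knotted (x 0) (x (p - 1)) (x 1)

end Digraph

/-- The inverse of a set of pairs. -/
def inversePairs {V : Type*} (I : Set (V × V)) : Set (V × V) := {p | (p.2, p.1) ∈ I}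

/-- `I` contains a circuit `(x 0, x 1), (x 1, x 2), …, (x (k - 1), x k)`, `x k = x 0`, of some
length `k ≥ 1`. -/
def ContainsCircuit {V : Type*} (I : Set (V × V)) : Prop :=
  ∃ (k : ℕ) (x : ℕ → V), 1 ≤ k ∧ x k = x 0 ∧ ∀ i < k, (x i, x (i + 1)) ∈ I

/-!
Condition 4 says that the adjacent pairs can be oriented consistently with forcing, and a strict
total order is a comparability ordering exactly when it induces such an orientation. The point is
to choose one that comes from an order. Well-order `V` and, of any two inverse implication classes,
select the one with the lexicographically smaller least element. If the classes of the sides of a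
triangle of digons differ at each vertex, then replacing a side by any member of its class yields
another such triangle, and comparing least elements shows that no triangle of digons is oriented
cyclically.

A single arc on no induced path is free: it may be ordered either way, and the free arcs form a
strict partial order. The other oriented pairs form an acyclic relation, so that every linear
extension of it is a comparability ordering. Indeed, all chords of a shortest cycle would be free.
For length at least five this is impossible, since the direction of a chord between vertices at
distance two would propagate around the cycle until it is reversed; lengths three and four are
excluded by inspecting the induced paths through the single arcs of the cycle.
-/

namespace ComparabilityDigraph

variable {V : Type*} {D : Digraph V}

/-! ### Forcing and knotting -/

/-- Arcs `ab` and `bc` whose chord `ac` is missing. These paths generate the forcing relation: up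
to symmetry, `(b, a)` directly forces `(b, c)` exactly when they lie on such a path. -/
def IsInducedPath (D : Digraph V) (a b c : V) : Prop :=
  a ≠ c ∧ D.Adj a b ∧ D.Adj b c ∧ ¬ D.Adj a c

theorem swap_mem_pairs {p : V × V} (h : p ∈ D.pairs) : p.swap ∈ D.pairs := Or.symm h

theorem ne_of_mem_pairs (hl : D.IsLoopless) {x y : V} (h : (x, y) ∈ D.pairs) : x ≠ y := by
  rintro rfl
  exact h.elim (hl x) (hl x)

theorem IsInducedPath.directlyForces {a b c : V} (h : IsInducedPath D a b c) :
    D.DirectlyForces (b, a) (b, c) :=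
  ⟨Or.inr h.2.1, Or.inl h.2.2.1, Or.inr (Or.inl ⟨rfl, h.1, Or.inl h.2⟩)⟩

theorem directlyForces_refl {p : V × V} (h : p ∈ D.pairs) : D.DirectlyForces p p :=
  ⟨h, h, Or.inl ⟨rfl, rfl⟩⟩

theorem directlyForces_symm {p q : V × V} (h : D.DirectlyForces p q) : D.DirectlyForces q p := by
  obtain ⟨hp, hq, ⟨h₁, h₂⟩ | ⟨h₁, h₂, h⟩ | ⟨h₁, h₂, h⟩⟩ := h
  · exact ⟨hq, hp, Or.inl ⟨h₁.symm, h₂.symm⟩⟩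
  · exact ⟨hq, hp, Or.inr (Or.inl ⟨h₁.symm, h₂.symm, h.symm⟩)⟩
  · exact ⟨hq, hp, Or.inr (Or.inr ⟨h₁.symm, h₂.symm, h.symm⟩)⟩

theorem directlyForces_swap {p q : V × V} (h : D.DirectlyForces p q) :
    D.DirectlyForces p.swap q.swap := by
  obtain ⟨hp, hq, ⟨h₁, h₂⟩ | h | h⟩ := h
  · exact ⟨swap_mem_pairs hp, swap_mem_pairs hq, Or.inl ⟨h₂, h₁⟩⟩
  · exact ⟨swap_mem_pairs hp, swap_mem_pairs hq, Or.inr (Or.inr h)⟩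
  · exact ⟨swap_mem_pairs hp, swap_mem_pairs hq, Or.inr (Or.inl h)⟩

theorem mem_pairs_of_forces {p q : V × V} (h : D.Forces p q) : p ∈ D.pairs ∧ q ∈ D.pairs := by
  induction h with
  | single h => exact ⟨h.1, h.2.1⟩
  | tail _ h ih => exact ⟨ih.1, h.2.1⟩

theorem forces_refl {p : V × V} (h : p ∈ D.pairs) : D.Forces p p :=
  .single (directlyForces_refl h)

theorem forces_symm {p q : V × V} (h : D.Forces p q) : D.Forces q p :=
  have : Std.Symm D.DirectlyForces := ⟨fun _ _ => directlyForces_symm⟩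
  Std.Symm.symm (r := Relation.TransGen D.DirectlyForces) _ _ h

theorem forces_swap {p q : V × V} (h : D.Forces p q) : D.Forces p.swap q.swap :=
  h.lift Prod.swap fun _ _ => directlyForces_swap

theorem IsInducedPath.forces {a b c : V} (h : IsInducedPath D a b c) : D.Forces (b, a) (b, c) :=
  .single h.directlyForces

theorem knotted_refl {x y : V} (h : (x, y) ∈ D.pairs) : D.Knotted x y y :=
  .single (directlyForces_refl h)

theorem knotted_symm {x y z : V} (h : D.Knotted x y z) : D.Knotted x z y :=
  have : Std.Symm fun y z => D.DirectlyForces (x, y) (x, z) := ⟨fun _ _ => directlyForces_symm⟩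
  Std.Symm.symm (r := Relation.TransGen fun y z => D.DirectlyForces (x, y) (x, z)) _ _ h

theorem forces_of_knotted {x y z : V} (h : D.Knotted x y z) : D.Forces (x, y) (x, z) :=
  h.lift (Prod.mk x) fun _ _ => id

theorem knotted_of_directlyForces {u v u' v' : V} (h : D.DirectlyForces (u, v) (u', v')) :
    D.Knotted v u u' ∧ D.Knotted u' v v' := by
  rcases h.2.2 with ⟨rfl, rfl⟩ | ⟨rfl, -⟩ | ⟨rfl, -⟩
  · exact ⟨knotted_refl (swap_mem_pairs h.1), knotted_refl h.1⟩
  · exact ⟨knotted_refl (swap_mem_pairs h.1), .single h⟩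
  · exact ⟨.single (directlyForces_swap h), knotted_refl h.2.1⟩

theorem forall_ne_inversePairs_iff :
    (∀ I ∈ D.implicationClasses, I ≠ inversePairs I) ↔ ∀ x y, ¬ D.Forces (x, y) (y, x) := by
  refine ⟨fun h x y hxy => ?_, ?_⟩
  · have hswap (q : V × V) (hq : D.Forces (x, y) q) : D.Forces (x, y) q.swap :=
      hxy.trans (forces_swap hq)
    exact h _ ⟨(x, y), (mem_pairs_of_forces hxy).1, rfl⟩
      (Set.ext fun q => ⟨hswap q, hswap q.swap⟩)
  · rintro h _ ⟨⟨x, y⟩, hp, rfl⟩ hI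
    have hmem : (x, y) ∈ inversePairs {q | D.Forces (x, y) q} := hI ▸ forces_refl hp
    exact h x y hmem

theorem not_forces_swap_of_forall_not_containsCircuit
    (h : ∀ I ∈ D.implicationClasses, ¬ ContainsCircuit I) (x y : V) :
    ¬ D.Forces (x, y) (y, x) := by
  intro hxy
  have hp := (mem_pairs_of_forces hxy).1
  refine h _ ⟨(x, y), hp, rfl⟩ ⟨2, fun i => if i = 1 then y else x, by decide, rfl, fun i hi => ?_⟩
  interval_cases i
  exacts [forces_refl hp, hxy]

/-! ### Odd closed knotting walks -/

theorem exists_isKnottingWalk_of_forces {p q : V × V} (h : D.Forces p q) :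
    ∃ (n : ℕ) (z : ℕ → V), z 0 = p.1 ∧ z 1 = p.2 ∧ z (2 * n) = q.1 ∧ z (2 * n + 1) = q.2 ∧
      D.IsKnottingWalk (2 * n + 1) z := by
  suffices ∀ {p r : V × V} {n : ℕ} {z : ℕ → V}, D.DirectlyForces p r → z 0 = r.1 → z 1 = r.2 →
      D.IsKnottingWalk (2 * n + 1) z →
      D.IsKnottingWalk (2 * (n + 1) + 1) (fun | 0 => p.1 | 1 => p.2 | i + 2 => z i) by
    induction h using Relation.TransGen.head_induction_on with
    | single h =>
      refine ⟨1, _, rfl, rfl, rfl, rfl, this (n := 0) (z := fun | 0 => q.1 | _ => q.2) h rfl rfl ?_⟩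
      intro i hi
      omega
    | head h _ ih =>
      obtain ⟨n, z, h₀, h₁, hn, hn', hz⟩ := ih
      exact ⟨n + 1, _, rfl, rfl, hn, hn', this h h₀ h₁ hz⟩
  rintro ⟨u, v⟩ ⟨u', v'⟩ n z h rfl rfl hz
  obtain ⟨hv, hu⟩ := knotted_of_directlyForces h
  rintro (_ | _ | i) hi
  exacts [hv, hu, hz i (by omega)]

theorem forces_of_isKnottingWalk {z : ℕ → V} {n : ℕ} (h : D.IsKnottingWalk (2 * n + 1) z)
    (h₀ : (z 0, z 1) ∈ D.pairs) : D.Forces (z 0, z 1) (z (2 * n), z (2 * n + 1)) := by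
  induction n with
  | zero => exact forces_refl h₀
  | succ n ih =>
    have h₁ := forces_swap (forces_of_knotted (h (2 * n) (by omega)))
    have h₂ := forces_of_knotted (h (2 * n + 1) (by omega))
    exact ((ih fun i hi => h i (by omega)).trans h₁).trans h₂

theorem exists_odd_isClosedKnottingWalk_iff :
    (∃ (p : ℕ) (x : ℕ → V), Odd p ∧ D.IsClosedKnottingWalk p x) ↔
      ∃ x y, D.Forces (x, y) (y, x) := by
  constructor
  · rintro ⟨_, x, ⟨n, rfl⟩, hx, hclosed, hknot⟩
    have hpair : (x 0, x 1) ∈ D.pairs := Digraph.mem_pairs_of_knotted hknot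
    have hforces := forces_of_isKnottingWalk hx hpair
    rw [hclosed] at hforces
    exact ⟨_, _, hforces.trans (forces_swap (forces_of_knotted hknot))⟩
  · rintro ⟨x, y, h⟩
    obtain ⟨n, z, h₀, h₁, hn, hn', hz⟩ := exists_isKnottingWalk_of_forces h
    refine ⟨2 * n + 1, z, ⟨n, rfl⟩, hz, hn'.trans h₀.symm, ?_⟩
    rw [h₀, Nat.add_sub_cancel, hn, h₁]
    exact knotted_refl (mem_pairs_of_forces h).1

/-! ### Forcing orientations -/

/-- The digraph with all arcs reversed. It has the same induced paths, read backwards, and thus the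
same forcing relation, so that it halves the case distinctions below. -/
def reverse (D : Digraph V) : Digraph V := ⟨fun x y => D.Adj y x⟩

/-- An orientation `S` of the adjacent pairs of `D` that is constant along the forcing relation,
that is, a union of implication classes containing exactly one of `I`, `I⁻¹` for each `I`. Only
the generating induced paths are mentioned; see `IsForcingOrientation.rel_iff_of_forces`. -/
structure IsForcingOrientation (D : Digraph V) (S : V → V → Prop) : Prop where
  total : ∀ {x y}, (x, y) ∈ D.pairs → S x y ∨ S y x
  asymm : ∀ {x y}, S x y → ¬ S y x
  rel_iff : ∀ {a b c}, IsInducedPath D a b c → (S b a ↔ S b c)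

theorem isSemicomplete_reverse (hs : D.IsSemicomplete) : (reverse D).IsSemicomplete :=
  fun x y hxy => (hs x y hxy).symm

theorem forces_reverse_iff {p q : V × V} : (reverse D).Forces p q ↔ D.Forces p q := by
  have key : ∀ {D : Digraph V} {p q : V × V}, D.DirectlyForces p q →
      (reverse D).DirectlyForces p q := by
    rintro D p q ⟨hp, hq, h | ⟨h₁, h₂, h⟩ | ⟨h₁, h₂, h⟩⟩
    · exact ⟨hp.symm, hq.symm, Or.inl h⟩
    · exact ⟨hp.symm, hq.symm, Or.inr (Or.inl ⟨h₁, h₂, h.symm.imp (by tauto) (by tauto)⟩)⟩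
    · exact ⟨hp.symm, hq.symm, Or.inr (Or.inr ⟨h₁, h₂, h.symm.imp (by tauto) (by tauto)⟩)⟩
  exact ⟨fun h => h.lift id fun _ _ => key (D := reverse D), fun h => h.lift id fun _ _ => key⟩

theorem IsInducedPath.of_reverse {a b c : V} (h : IsInducedPath (reverse D) a b c) :
    IsInducedPath D c b a :=
  ⟨h.1.symm, h.2.2.1, h.2.1, h.2.2.2⟩

namespace IsForcingOrientation

variable {S : V → V → Prop} {a b c x y : V}

theorem swap_iff (h : IsForcingOrientation D S) (hxy : (x, y) ∈ D.pairs) : S y x ↔ ¬ S x y :=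
  ⟨h.asymm, (h.total hxy).resolve_left⟩

theorem ne (h : IsForcingOrientation D S) (hxy : S x y) : x ≠ y := by
  rintro rfl
  exact h.asymm hxy hxy

theorem rel_swap_iff (h : IsForcingOrientation D S) (hp : IsInducedPath D a b c) :
    S a b ↔ S c b := by
  rw [h.swap_iff (Or.inr hp.2.1), h.swap_iff (Or.inl hp.2.2.1), h.rel_iff hp]

protected theorem reverse (h : IsForcingOrientation D S) : IsForcingOrientation (reverse D) S where
  total hxy := h.total (Or.symm hxy)
  asymm := h.asymm
  rel_iff hp := (h.rel_iff hp.of_reverse).symm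

protected theorem flip (h : IsForcingOrientation D S) : IsForcingOrientation D (flip S) where
  total hxy := h.total (Or.symm hxy)
  asymm := h.asymm
  rel_iff := h.rel_swap_iff

theorem forward (h : IsForcingOrientation D S) (hab : S a b) (hbc : S b c) (ab : D.Adj a b)
    (bc : D.Adj b c) : D.Adj a c := by
  by_contra ac
  have hac : a ≠ c := fun e => h.asymm hab (e ▸ hbc)
  exact h.asymm hab ((h.rel_iff ⟨hac, ab, bc, ac⟩).2 hbc)

theorem backward (h : IsForcingOrientation D S) (hab : S a b) (hbc : S b c) (cb : D.Adj c b)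
    (ba : D.Adj b a) : D.Adj c a :=
  h.reverse.forward hab hbc ba cb

theorem rel_iff_of_directlyForces (h : IsForcingOrientation D S) {p q : V × V}
    (hpq : D.DirectlyForces p q) : S p.1 p.2 ↔ S q.1 q.2 := by
  obtain ⟨u, v⟩ := p
  obtain ⟨u', v'⟩ := q
  obtain ⟨-, -, ⟨rfl, rfl⟩ | ⟨rfl, hne, hp | hp⟩ | ⟨rfl, hne, hp | hp⟩⟩ := hpq
  · rfl
  · exact h.rel_iff ⟨hne, hp⟩
  · exact (h.rel_iff ⟨hne.symm, hp⟩).symm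
  · exact h.rel_swap_iff ⟨hne, hp⟩
  · exact (h.rel_swap_iff ⟨hne.symm, hp⟩).symm

theorem rel_iff_of_forces (h : IsForcingOrientation D S) {p q : V × V} (hpq : D.Forces p q) :
    S p.1 p.2 ↔ S q.1 q.2 := by
  induction hpq with
  | single hpq => exact h.rel_iff_of_directlyForces hpq
  | tail _ hpq ih => exact ih.trans (h.rel_iff_of_directlyForces hpq)

theorem not_forces_swap (h : IsForcingOrientation D S) (x y : V) : ¬ D.Forces (x, y) (y, x) := by
  intro hxy
  have hflip : S y x ↔ ¬ S x y := h.swap_iff (mem_pairs_of_forces hxy).1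
  exact iff_not_self ((h.rel_iff_of_forces hxy).trans hflip)

end IsForcingOrientation

theorem isComparabilityOrdering_iff (hl : D.IsLoopless) {r : V → V → Prop} :
    D.IsComparabilityOrdering r ↔ IsStrictTotalOrder V r ∧ IsForcingOrientation D r := by
  refine ⟨fun h => ⟨h.strictTotal, ?_⟩, fun ⟨hr, h⟩ => ⟨hr, ?_, ?_⟩⟩
  · have := h.strictTotal
    have total {x y : V} (hxy : (x, y) ∈ D.pairs) : r x y ∨ r y x :=
      (trichotomous_of r x y).imp_right (Or.resolve_left · (ne_of_mem_pairs hl hxy))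
    refine ⟨total, fun hxy hyx => asymm_of r hxy hyx, fun {a b c} ⟨_, hab, hbc, hac⟩ => ?_⟩
    refine ⟨fun hba => ?_, fun hbc' => ?_⟩
    · exact (total (Or.inl hbc)).resolve_right fun hcb => hac (h.backward c b a hcb hba hab hbc)
    · exact (total (Or.inr hab)).resolve_right fun hab' => hac (h.forward a b c hab' hbc' hab hbc)
  · exact fun x y z => h.forward
  · exact fun x y z => h.backward

theorem not_containsCircuit_of_isForcingOrientation {r : V → V → Prop} [IsStrictOrder V r]
    (h : IsForcingOrientation D r) {I : Set (V × V)} (hI : I ∈ D.implicationClasses) :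
    ¬ ContainsCircuit I := by
  rintro ⟨k, x, hk, hx, hI'⟩
  obtain ⟨p, hp, rfl⟩ := hI
  wlog hr : r p.1 p.2 generalizing r
  · have hflip : IsStrictOrder V (flip r) := inferInstanceAs (IsStrictOrder V (Function.swap r))
    exact this h.flip ((h.swap_iff hp).2 hr)
  · have hstep : ∀ i ∈ Set.Ico 0 k, r (x i) (x (i + 1)) :=
      fun i hi => (h.rel_iff_of_forces (hI' i hi.2)).1 hr
    have hcycle : Relation.TransGen r (x 0) (x k) :=
      (transGen_of_succ_of_lt (fun i j => r (x i) (x j)) hstep hk).lift x fun _ _ => id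
    rw [hx, Relation.transGen_eq_self] at hcycle
    exact irrefl_of r _ hcycle

/-! ### The knotting graph -/

/-- The vertex of the knotting graph given by `x` and the class of `y` in the neighbourhood
of `x`. -/
def partialCopy {x y : V} (h : (x, y) ∈ D.pairs) : D.PartialCopy :=
  ⟨(x, {z | D.Knotted x y z}), y, h, rfl⟩

theorem partialCopy_eq {x y z : V} (hy : (x, y) ∈ D.pairs) (hz : (x, z) ∈ D.pairs)
    (h : D.Knotted x y z) : partialCopy hy = partialCopy hz := by
  have hset : {w | D.Knotted x y w} = {w | D.Knotted x z w} :=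
    Set.ext fun w => ⟨(knotted_symm h).trans, h.trans⟩
  exact Subtype.ext (congrArg (Prod.mk x) hset)

theorem knottingGraph_adj_partialCopy (hl : D.IsLoopless) {x y : V} (h : (x, y) ∈ D.pairs) :
    (D.knottingGraph hl).Adj (partialCopy h) (partialCopy (swap_mem_pairs h)) :=
  ⟨knotted_refl h, knotted_refl (swap_mem_pairs h)⟩

theorem knotted_of_mem (u : D.PartialCopy) {y z : V} (hy : y ∈ u.1.2) (hz : z ∈ u.1.2) :
    D.Knotted u.1.1 y z := by
  obtain ⟨w, -, hw⟩ := u.2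
  rw [hw] at hy hz
  exact (knotted_symm hy).trans hz

theorem exists_isForcingOrientation_of_isBipartite (hl : D.IsLoopless)
    (h : (D.knottingGraph hl).IsBipartite) : ∃ S, IsForcingOrientation D S := by
  obtain ⟨C⟩ := h
  have hC {x y : V} (hxy : (x, y) ∈ D.pairs) :
      C (partialCopy hxy) ≠ C (partialCopy (swap_mem_pairs hxy)) :=
    C.valid (knottingGraph_adj_partialCopy hl hxy)
  refine ⟨fun x y => ∃ hxy : (x, y) ∈ D.pairs, C (partialCopy hxy) = 0, ?_, ?_, ?_⟩
  · intro x y hxy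
    by_cases h₀ : C (partialCopy hxy) = 0
    · exact Or.inl ⟨hxy, h₀⟩
    · have := hC hxy
      exact Or.inr ⟨swap_mem_pairs hxy, by omega⟩
  · rintro x y ⟨hxy, h₀⟩ ⟨_, h₁⟩
    exact hC hxy (h₀.trans h₁.symm)
  · intro a b c hp
    have heq := partialCopy_eq (Or.inr hp.2.1) (Or.inl hp.2.2.1) (.single hp.directlyForces)
    exact ⟨fun ⟨_, h₀⟩ => ⟨Or.inl hp.2.2.1, heq ▸ h₀⟩, fun ⟨_, h₀⟩ => ⟨Or.inr hp.2.1, heq ▸ h₀⟩⟩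

theorem isBipartite_of_isForcingOrientation (hl : D.IsLoopless) {S : V → V → Prop}
    (h : IsForcingOrientation D S) : (D.knottingGraph hl).IsBipartite := by
  have rel_iff (u : D.PartialCopy) {y : V} (hy : y ∈ u.1.2) :
      (∃ z ∈ u.1.2, S u.1.1 z) ↔ S u.1.1 y := by
    refine ⟨fun ⟨z, hz, hS⟩ => ?_, fun hS => ⟨y, hy, hS⟩⟩
    exact (h.rel_iff_of_forces (forces_of_knotted (knotted_of_mem u hy hz))).2 hS
  let C : (D.knottingGraph hl).Coloring Prop :=
    SimpleGraph.Coloring.mk (fun u => ∃ z ∈ u.1.2, S u.1.1 z) fun {u v} huv heq => by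
      rw [eq_iff_iff, rel_iff u huv.1, rel_iff v huv.2] at heq
      have hpair := Digraph.mem_pairs_of_knotted (knotted_of_mem u huv.1 huv.1)
      exact iff_not_self (heq.trans (h.swap_iff hpair))
  simpa only [Fintype.card_prop] using C.colorable

/-! ### Triangles of digons -/

/-- Arcs join `x` and `y` in both directions. -/
def IsDigon (D : Digraph V) (x y : V) : Prop := D.Adj x y ∧ D.Adj y x

/-- Three vertices, any two of which span a digon, such that at each of them the two pairs leading
to the other two vertices lie in different implication classes. The notion is invariant under
all permutations of the vertices. -/
structure IsRainbowTriangle (D : Digraph V) (a b c : V) : Prop where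
  digon₁₂ : IsDigon D a b
  digon₂₃ : IsDigon D b c
  digon₁₃ : IsDigon D a c
  not_forces₁ : ¬ D.Forces (a, b) (a, c)
  not_forces₂ : ¬ D.Forces (b, c) (b, a)
  not_forces₃ : ¬ D.Forces (c, a) (c, b)

theorem IsDigon.symm {x y : V} (h : IsDigon D x y) : IsDigon D y x := ⟨h.2, h.1⟩

namespace IsRainbowTriangle

variable {a b c : V}

theorem rotate (h : IsRainbowTriangle D a b c) : IsRainbowTriangle D b c a :=
  ⟨h.digon₂₃, h.digon₁₃.symm, h.digon₁₂.symm, h.not_forces₂, h.not_forces₃, h.not_forces₁⟩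

theorem swap₂₃ (h : IsRainbowTriangle D a b c) : IsRainbowTriangle D a c b :=
  ⟨h.digon₁₃, h.digon₂₃.symm, h.digon₁₂, fun hf => h.not_forces₁ (forces_symm hf),
    fun hf => h.not_forces₃ (forces_symm hf), fun hf => h.not_forces₂ (forces_symm hf)⟩

protected theorem reverse (h : IsRainbowTriangle D a b c) :
    IsRainbowTriangle (reverse D) a b c where
  digon₁₂ := h.digon₁₂.symm
  digon₂₃ := h.digon₂₃.symm
  digon₁₃ := h.digon₁₃.symm
  not_forces₁ := mt forces_reverse_iff.1 h.not_forces₁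
  not_forces₂ := mt forces_reverse_iff.1 h.not_forces₂
  not_forces₃ := mt forces_reverse_iff.1 h.not_forces₃

theorem isDigon_of_isInducedPath (hl : D.IsLoopless) (hs : D.IsSemicomplete)
    (h : IsRainbowTriangle D a b c) {c' : V} (hp : IsInducedPath D c b c') :
    D.Forces (a, c) (a, c') ∧ IsDigon D a c' ∧ IsDigon D b c' := by
  have bc_bc' : D.Forces (b, c) (b, c') := hp.forces
  obtain ⟨hcc', -, bc', cc'⟩ := hp
  have hbc' : b ≠ c' := fun e => hl b (e ▸ bc')
  have hac' : a ≠ c' := fun e => cc' (e ▸ h.digon₁₃.2)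
  have c'c : D.Adj c' c := (hs c c' hcc').resolve_left cc'
  have ac' : D.Adj a c' := by
    by_contra ac'
    have ba_bc' : D.Forces (b, a) (b, c') := IsInducedPath.forces ⟨hac', h.digon₁₂.1, bc', ac'⟩
    exact h.not_forces₂ (bc_bc'.trans (forces_symm ba_bc'))
  have ac_ac' : D.Forces (a, c) (a, c') := IsInducedPath.forces ⟨hcc', h.digon₁₃.2, ac', cc'⟩
  have c'b : D.Adj c' b := by
    by_contra c'b
    have cc'_cb : D.Forces (c, c') (c, b) :=
      IsInducedPath.forces ⟨hbc'.symm, c'c, h.digon₂₃.2, c'b⟩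
    by_cases c'a : D.Adj c' a
    · have ac'_ab : D.Forces (a, c') (a, b) :=
        IsInducedPath.forces ⟨hbc'.symm, c'a, h.digon₁₂.1, c'b⟩
      exact h.not_forces₁ (forces_symm (ac_ac'.trans ac'_ab))
    · have cc'_ca : D.Forces (c, c') (c, a) :=
        IsInducedPath.forces ⟨hac'.symm, c'c, h.digon₁₃.2, c'a⟩
      exact h.not_forces₃ ((forces_symm cc'_ca).trans cc'_cb)
  have c'a : D.Adj c' a := by
    by_contra c'a
    have bc'_ba : D.Forces (b, c') (b, a) :=
      IsInducedPath.forces ⟨hac'.symm, c'b, h.digon₁₂.2, c'a⟩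
    exact h.not_forces₂ (bc_bc'.trans bc'_ba)
  exact ⟨ac_ac', ⟨ac', c'a⟩, bc', c'b⟩

theorem of_isInducedPath (hl : D.IsLoopless) (hs : D.IsSemicomplete)
    (h : IsRainbowTriangle D a b c) {c' : V} (hp : IsInducedPath D c b c') :
    IsRainbowTriangle D a b c' ∧ D.Forces (a, c) (a, c') := by
  obtain ⟨ac_ac', ac', bc'⟩ := h.isDigon_of_isInducedPath hl hs hp
  have bc_bc' := hp.forces
  refine ⟨⟨h.digon₁₂, bc', ac', fun hf => ?_, fun hf => ?_, fun hf => ?_⟩, ac_ac'⟩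
  · exact h.not_forces₁ (hf.trans (forces_symm ac_ac'))
  · exact h.not_forces₂ (bc_bc'.trans hf)
  · exact h.not_forces₃ (((forces_swap ac_ac').trans hf).trans (forces_symm (forces_swap bc_bc')))

theorem of_directlyForces_right (hl : D.IsLoopless) (hs : D.IsSemicomplete)
    (h : IsRainbowTriangle D a b c) {c' : V} (hf : D.DirectlyForces (b, c) (b, c')) :
    IsRainbowTriangle D a b c' ∧ D.Forces (a, c) (a, c') := by
  obtain ⟨-, -, ⟨-, rfl⟩ | ⟨-, hne, hp | ⟨c'b, bc, c'c⟩⟩ | ⟨-, hne, -⟩⟩ := hf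
  · exact ⟨h, forces_refl (Or.inl h.digon₁₃.1)⟩
  · exact h.of_isInducedPath hl hs ⟨hne, hp⟩
  · have hp : IsInducedPath (reverse D) c b c' := ⟨hne, bc, c'b, c'c⟩
    obtain ⟨h', hf⟩ := of_isInducedPath (D := reverse D) hl (isSemicomplete_reverse hs) h.reverse hp
    exact ⟨h'.reverse, forces_reverse_iff.1 hf⟩
  · exact absurd rfl hne

theorem of_directlyForces (hl : D.IsLoopless) (hs : D.IsSemicomplete) {p q : V × V}
    (h : IsRainbowTriangle D a p.1 p.2) (hf : D.DirectlyForces p q) :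
    IsRainbowTriangle D a q.1 q.2 ∧ D.Forces (a, p.1) (a, q.1) ∧ D.Forces (a, p.2) (a, q.2) := by
  obtain ⟨b, c⟩ := p
  obtain ⟨b', c'⟩ := q
  have hsame : b = b' ∨ c = c' := by
    rcases hf.2.2 with ⟨hb, -⟩ | ⟨hb, -⟩ | ⟨hc, -⟩
    exacts [Or.inl hb, Or.inl hb, Or.inr hc]
  obtain rfl | rfl := hsame
  · obtain ⟨h', hcc'⟩ := h.of_directlyForces_right hl hs hf
    exact ⟨h', forces_refl (Or.inl h.digon₁₂.1), hcc'⟩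
  · obtain ⟨h', hbb'⟩ := h.swap₂₃.of_directlyForces_right (c' := b') hl hs
        (directlyForces_swap hf)
    exact ⟨h'.swap₂₃, hbb', forces_refl (Or.inl h.digon₁₃.1)⟩

theorem of_forces (hl : D.IsLoopless) (hs : D.IsSemicomplete) (h : IsRainbowTriangle D a b c)
    {q : V × V} (hf : D.Forces (b, c) q) :
    IsRainbowTriangle D a q.1 q.2 ∧ D.Forces (a, b) (a, q.1) ∧ D.Forces (a, c) (a, q.2) := by
  induction hf with
  | single hf => exact h.of_directlyForces hl hs hf
  | tail _ hf ih =>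
    obtain ⟨h', hb, hc⟩ := ih
    obtain ⟨h'', hb', hc'⟩ := h'.of_directlyForces hl hs hf
    exact ⟨h'', hb.trans hb', hc.trans hc'⟩

theorem forces_swap_fst (hl : D.IsLoopless) (hs : D.IsSemicomplete) (h : IsRainbowTriangle D a b c)
    {q : V × V} (hf : D.Forces (b, c) q) : D.Forces (b, a) (q.1, a) :=
  forces_swap (h.of_forces hl hs hf).2.1

theorem disjoint_fst (hl : D.IsLoopless) (hs : D.IsSemicomplete) (h : IsRainbowTriangle D a b c)
    {p q : V × V} (hp : D.Forces (a, b) p) (hq : D.Forces (b, a) q) : p.1 ≠ q.1 := by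
  intro hpq
  have hca : D.Forces (c, a) (c, p.1) := (h.rotate.rotate.of_forces hl hs hp).2.1
  have hcb : D.Forces (c, b) (c, q.1) := (h.rotate.rotate.swap₂₃.of_forces hl hs hq).2.1
  exact h.not_forces₃ (hca.trans (hpq ▸ forces_symm hcb))

end IsRainbowTriangle

/-! ### The lexicographically selected orientation -/

/-- Of the implication classes of `(x, y)` and `(y, x)`, the former has the lexicographically
smaller least element. When the two are distinct, this selects exactly one of them, and the
choices agree on triangles of digons. -/
def Selected [LinearOrder V] (D : Digraph V) (x y : V) : Prop :=
  ∃ p, D.Forces (x, y) p ∧ ∀ q, D.Forces (y, x) q → toLex p < toLex q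

/-- A forcing orientation without cyclically oriented triangles of digons. -/
structure IsDigonTransitiveOrientation (D : Digraph V) (S : V → V → Prop) : Prop
    extends IsForcingOrientation D S where
  trans : ∀ {a b c}, IsDigon D a b → IsDigon D b c → IsDigon D a c → S a b → S b c → S a c

section Selected

variable [LinearOrder V]

theorem Selected.of_forces {x y x' y' : V} (h : Selected D x y)
    (hf : D.Forces (x, y) (x', y')) : Selected D x' y' := by
  obtain ⟨p, hp, hlt⟩ := h
  exact ⟨p, (forces_symm hf).trans hp, fun q hq => hlt q ((forces_swap hf).trans hq)⟩

theorem Selected.exists_fst_le {x y : V} (h : Selected D x y) {q : V × V}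
    (hq : D.Forces (y, x) q) : ∃ p, D.Forces (x, y) p ∧ p.1 ≤ q.1 := by
  obtain ⟨p, hp, hlt⟩ := h
  exact ⟨p, hp, (Prod.Lex.toLex_lt_toLex'.1 (hlt q hq)).1⟩

theorem Selected.asymm {x y : V} (h : Selected D x y) : ¬ Selected D y x := by
  rintro ⟨q, hq, hlt'⟩
  obtain ⟨p, hp, hlt⟩ := h
  exact lt_asymm (hlt q hq) (hlt' p hp)

variable [WellFoundedLT V]

theorem selected_total {x y : V} (hxy : (x, y) ∈ D.pairs) (hF : ¬ D.Forces (x, y) (y, x)) :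
    Selected D x y ∨ Selected D y x := by
  obtain ⟨m, hm, hmin⟩ := (wellFounded_lt (α := V ×ₗ V)).has_min
    {r | D.Forces (x, y) (ofLex r) ∨ D.Forces (y, x) (ofLex r)}
    ⟨toLex (x, y), Or.inl (forces_refl hxy)⟩
  have lt_of_forces {q : V × V} (hq : D.Forces (x, y) q ∨ D.Forces (y, x) q)
      (hne : ofLex m ≠ q) : m < toLex q :=
    (not_lt.1 (hmin (toLex q) hq)).lt_of_ne fun e => hne e
  rcases hm with hm | hm
  · refine Or.inl ⟨ofLex m, hm, fun q hq => lt_of_forces (Or.inr hq) ?_⟩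
    rintro rfl
    exact hF (hm.trans (forces_symm hq))
  · refine Or.inr ⟨ofLex m, hm, fun q hq => lt_of_forces (Or.inl hq) ?_⟩
    rintro rfl
    exact hF (hq.trans (forces_symm hm))

theorem isForcingOrientation_selected (hF : ∀ x y, ¬ D.Forces (x, y) (y, x)) :
    IsForcingOrientation D (Selected D) where
  total hxy := selected_total hxy (hF _ _)
  asymm := Selected.asymm
  rel_iff hp := ⟨fun h => h.of_forces hp.forces, fun h => h.of_forces (forces_symm hp.forces)⟩

theorem IsRainbowTriangle.not_selected_cyclic (hl : D.IsLoopless) (hs : D.IsSemicomplete)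
    {a b c : V} (h : IsRainbowTriangle D a b c) (hab : Selected D a b) (hbc : Selected D b c) :
    ¬ Selected D c a := by
  intro hca
  obtain ⟨u, ⟨p, hp, rfl⟩, hmin⟩ := (wellFounded_lt (α := V)).has_min
    {u | ∃ p, D.Forces (b, a) p ∧ p.1 = u} ⟨b, _, forces_refl (Or.inl h.digon₁₂.2), rfl⟩
  obtain ⟨p₁, hp₁, hle₁⟩ := hab.exists_fst_le hp
  obtain ⟨p₂, hp₂, hle₂⟩ := hca.exists_fst_le (h.rotate.rotate.forces_swap_fst hl hs hp₁)
  obtain ⟨p₃, hp₃, hle₃⟩ := hbc.exists_fst_le (h.rotate.forces_swap_fst hl hs hp₂)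
  have hle : p.1 ≤ p₃.1 := not_lt.1 (hmin _ ⟨_, h.forces_swap_fst hl hs hp₃, rfl⟩)
  exact h.disjoint_fst hl hs hp₁ hp (hle₁.antisymm (hle.trans (hle₃.trans hle₂)))

theorem isDigonTransitiveOrientation_selected (hl : D.IsLoopless) (hs : D.IsSemicomplete)
    (hF : ∀ x y, ¬ D.Forces (x, y) (y, x)) :
    IsDigonTransitiveOrientation D (Selected D) where
  __ := isForcingOrientation_selected hF
  trans {a b c} ab bc ac hab hbc := by
    refine ((isForcingOrientation_selected hF).total (Or.inl ac.1)).resolve_right fun hca => ?_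
    have h : IsRainbowTriangle D a b c := ⟨ab, bc, ac, fun hf => hca.asymm (hab.of_forces hf),
      fun hf => hab.asymm (hbc.of_forces hf), fun hf => hbc.asymm (hca.of_forces hf)⟩
    exact h.not_selected_cyclic hl hs hab hbc hca

end Selected

theorem exists_isDigonTransitiveOrientation (hl : D.IsLoopless) (hs : D.IsSemicomplete)
    (hF : ∀ x y, ¬ D.Forces (x, y) (y, x)) : ∃ S, IsDigonTransitiveOrientation D S := by
  obtain ⟨_, _⟩ := exists_wellFoundedLT V
  exact ⟨Selected D, isDigonTransitiveOrientation_selected hl hs hF⟩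

/-! ### Bound pairs -/

/-- There is an arc from `x` to `y` and none back. -/
def IsSingleArc (D : Digraph V) (x y : V) : Prop := D.Adj x y ∧ ¬ D.Adj y x

/-- A single arc that directly forces only itself: it lies on no induced path, so that a
comparability ordering may orient it either way. -/
def IsFree (D : Digraph V) (x y : V) : Prop :=
  IsSingleArc D x y ∧ (∀ a, D.Adj a x → D.Adj a y) ∧ ∀ a, D.Adj y a → D.Adj x a

/-- The pairs of an orientation `S` that an ordering has to respect. -/
def IsBound (D : Digraph V) (S : V → V → Prop) (x y : V) : Prop :=
  S x y ∧ ¬ IsFree D x y ∧ ¬ IsFree D y x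

theorem IsSingleArc.isInducedPath {a b c : V} (hca : IsSingleArc D c a) (ab : D.Adj a b)
    (bc : D.Adj b c) : IsInducedPath D a b c := by
  refine ⟨?_, ab, bc, hca.2⟩
  rintro rfl
  exact hca.2 hca.1

theorem IsFree.irrefl (x : V) : ¬ IsFree D x x := fun h => h.1.2 h.1.1

theorem IsFree.trans {x y z : V} (hxy : IsFree D x y) (hyz : IsFree D y z) : IsFree D x z :=
  ⟨⟨hyz.2.1 _ hxy.1.1, fun hzx => hyz.1.2 (hxy.2.1 _ hzx)⟩,
    fun a ha => hyz.2.1 a (hxy.2.1 a ha), fun a ha => hxy.2.2 a (hyz.2.2 a ha)⟩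

theorem isFree_reverse_iff {x y : V} : IsFree (reverse D) x y ↔ IsFree D y x :=
  and_congr Iff.rfl and_comm

theorem isBound_reverse_iff {S : V → V → Prop} {x y : V} :
    IsBound (reverse D) S x y ↔ IsBound D S x y :=
  and_congr Iff.rfl ((and_congr (not_congr isFree_reverse_iff) (not_congr isFree_reverse_iff)).trans
    and_comm)

/-- The relation `S` runs around the triangle `a`, `b`, `c` in this cyclic order. -/
structure IsCyclicTriangle (S : V → V → Prop) (a b c : V) : Prop where
  rel₁₂ : S a b
  rel₂₃ : S b c
  rel₃₁ : S c a

theorem IsCyclicTriangle.rotate {S : V → V → Prop} {a b c : V} (h : IsCyclicTriangle S a b c) :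
    IsCyclicTriangle S b c a :=
  ⟨h.rel₂₃, h.rel₃₁, h.rel₁₂⟩

theorem IsCyclicTriangle.flip {S : V → V → Prop} {a b c : V} (h : IsCyclicTriangle S a b c) :
    IsCyclicTriangle (flip S) a c b :=
  ⟨h.rel₃₁, h.rel₂₃, h.rel₁₂⟩

namespace IsForcingOrientation

variable {S : V → V → Prop} {a b c p q r w : V}

theorem loopless (h : IsForcingOrientation D S) : D.IsLoopless := fun _ hx =>
  (h.total (Or.inl hx)).elim (fun hS => h.ne hS rfl) fun hS => h.ne hS rfl

theorem mem_pairs_of_rel (h : IsForcingOrientation D S) (hs : D.IsSemicomplete) (hab : S a b) :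
    (a, b) ∈ D.pairs :=
  hs a b (h.ne hab)

theorem not_singleArc_triangle (h : IsForcingOrientation D S) (hpq : IsSingleArc D p q)
    (hqr : IsSingleArc D q r) : ¬ IsSingleArc D r p := by
  intro hrp
  have hp : S p r ↔ S p q := h.rel_iff (hqr.isInducedPath hrp.1 hpq.1)
  have hq : S q p ↔ S q r := h.rel_iff (hrp.isInducedPath hpq.1 hqr.1)
  have hr : S r q ↔ S r p := h.rel_iff (hpq.isInducedPath hqr.1 hrp.1)
  have hpq' := h.swap_iff (Or.inl hpq.1)
  have hqr' := h.swap_iff (Or.inl hqr.1)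
  have hrp' := h.swap_iff (Or.inl hrp.1)
  tauto

theorem exists_witness_of_not_isFree (h : IsForcingOrientation D S) (hs : D.IsSemicomplete)
    (hpr : IsSingleArc D p r) (hfree : ¬ IsFree D p r) :
    ∃ w, (IsDigon D w p ∧ IsSingleArc D r w) ∨ (IsDigon D w r ∧ IsSingleArc D w p) := by
  obtain ⟨w, ⟨wp, wr⟩ | ⟨rw, pw⟩⟩ :
      ∃ w, (D.Adj w p ∧ ¬ D.Adj w r) ∨ (D.Adj r w ∧ ¬ D.Adj p w) := by
    by_contra! hnot
    exact hfree ⟨hpr, fun w => (hnot w).1, fun w => (hnot w).2⟩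
  · have hne : r ≠ w := fun e => hpr.2 (e ▸ wp)
    have hrw : IsSingleArc D r w := ⟨(hs r w hne).resolve_right wr, wr⟩
    have pw : D.Adj p w := by
      by_contra pw
      exact h.not_singleArc_triangle hpr hrw ⟨wp, pw⟩
    exact ⟨w, Or.inl ⟨⟨wp, pw⟩, hrw⟩⟩
  · have hne : w ≠ p := fun e => hpr.2 (e ▸ rw)
    have hwp : IsSingleArc D w p := ⟨(hs w p hne).resolve_right pw, pw⟩
    have wr : D.Adj w r := by
      by_contra wr
      exact h.not_singleArc_triangle hpr ⟨rw, wr⟩ hwp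
    exact ⟨w, Or.inr ⟨⟨wr, rw⟩, hwp⟩⟩

theorem not_isCyclicTriangle_of_witness_left (h : IsForcingOrientation D S)
    (hpr : IsSingleArc D p r) (hwp : IsDigon D w p)
    (hrw : IsSingleArc D r w) (hqr : IsSingleArc D q r) (pq : D.Adj p q) :
    ¬ IsCyclicTriangle S p q r := by
  rintro ⟨Spq, Sqr, Srp⟩
  have Swp : S w p := (h.swap_iff (Or.inl hwp.2)).2 fun Spw =>
    h.asymm Srp ((h.rel_iff (hrw.isInducedPath hwp.1 hpr.1)).1 Spw)
  have Swr : S w r := (h.rel_iff (hpr.isInducedPath hrw.1 hwp.1)).2 Swp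
  have wq : ¬ D.Adj w q := fun wq =>
    have Sqw : S q w := (h.rel_iff (hrw.isInducedPath wq hqr.1)).2 Sqr
    have Swq : S w q := (h.rel_iff (hqr.isInducedPath hrw.1 wq)).1 Swr
    h.asymm Sqw Swq
  have hne : w ≠ q := fun e => h.asymm Swp (e ▸ Spq)
  exact h.asymm Swp ((h.rel_iff ⟨hne, hwp.1, pq, wq⟩).2 Spq)

theorem not_isCyclicTriangle_of_witness_right (h : IsForcingOrientation D S)
    (hpr : IsSingleArc D p r) (hwr : IsDigon D w r)
    (hwp : IsSingleArc D w p) (hpq : IsSingleArc D p q) (qr : D.Adj q r) :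
    ¬ IsCyclicTriangle S p q r := fun hc =>
  h.flip.reverse.not_isCyclicTriangle_of_witness_left hpr hwr.symm hwp hpq
    qr hc.flip.rotate

theorem not_isCyclicTriangle_of_transitive (h : IsForcingOrientation D S) (hs : D.IsSemicomplete)
    (hpq : IsSingleArc D p q) (hqr : IsSingleArc D q r) (hpr : IsSingleArc D p r)
    (hfree : ¬ IsFree D p r) : ¬ IsCyclicTriangle S p q r := by
  obtain ⟨w, ⟨hwp, hrw⟩ | ⟨hwr, hwp⟩⟩ := h.exists_witness_of_not_isFree hs hpr hfree
  · exact h.not_isCyclicTriangle_of_witness_left hpr hwp hrw hqr hpq.1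
  · exact h.not_isCyclicTriangle_of_witness_right hpr hwr hwp hpq hqr.1

end IsForcingOrientation

namespace IsDigonTransitiveOrientation

variable {S : V → V → Prop} {a b c p q r : V}

protected theorem reverse (h : IsDigonTransitiveOrientation D S) :
    IsDigonTransitiveOrientation (reverse D) S where
  __ := h.toIsForcingOrientation.reverse
  trans ab bc ac := h.trans ab.symm bc.symm ac.symm

protected theorem flip (h : IsDigonTransitiveOrientation D S) :
    IsDigonTransitiveOrientation D (flip S) where
  __ := h.toIsForcingOrientation.flip
  trans ab bc ac Sba Scb := h.trans bc.symm ab.symm ac.symm Scb Sba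

theorem not_isCyclicTriangle_of_isDigon (h : IsDigonTransitiveOrientation D S)
    (hs : D.IsSemicomplete) (hpq : IsDigon D p q) (hpr : IsSingleArc D p r)
    (hqr : IsSingleArc D q r) (hpr' : ¬ IsFree D p r) (hqr' : ¬ IsFree D q r) :
    ¬ IsCyclicTriangle S p q r := by
  intro hc
  obtain ⟨w, ⟨hwp, hrw⟩ | ⟨hwr, hwp⟩⟩ := h.exists_witness_of_not_isFree hs hpr hpr'
  · exact h.not_isCyclicTriangle_of_witness_left hpr hwp hrw hqr hpq.1 hc
  obtain ⟨u, ⟨huq, hru⟩ | ⟨hur, huq⟩⟩ := h.exists_witness_of_not_isFree hs hqr hqr'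
  · exact h.flip.not_isCyclicTriangle_of_witness_left hqr huq hru hpr hpq.2 hc.flip.rotate.rotate
  obtain ⟨Spq, Sqr, Srp⟩ := hc
  have Srw : S r w := (h.rel_iff (hwp.isInducedPath hpr.1 hwr.2)).1 Srp
  have Sur : S u r := (h.swap_iff (Or.inl hur.2)).2 fun Sru =>
    h.asymm Sqr ((h.rel_iff (huq.isInducedPath hqr.1 hur.2)).2 Sru)
  have huw : IsDigon D u w := ⟨h.forward Sur Srw hur.1 hwr.2, h.backward Sur Srw hwr.1 hur.2⟩
  have Suw : S u w := h.trans hur hwr.symm huw Sur Srw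
  have pu : D.Adj p u := h.backward Sur Srp hpr.1 hur.2
  have Spu : S p u := (h.rel_iff (huq.isInducedPath hpq.2 pu)).1 Spq
  have Sup : S u p := (h.rel_iff (hwp.isInducedPath pu huw.1)).2 Suw
  exact h.asymm Spu Sup

theorem not_isSingleArc_of_isCyclicTriangle_isBound (h : IsDigonTransitiveOrientation D S)
    (hs : D.IsSemicomplete) (hc : IsCyclicTriangle (IsBound D S) a b c) : ¬ IsSingleArc D a b := by
  intro hab
  obtain ⟨⟨Sab, hab', -⟩, ⟨Sbc, -, hcb'⟩, ⟨Sca, -, hac'⟩⟩ := hc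
  have hc : IsCyclicTriangle S a b c := ⟨Sab, Sbc, Sca⟩
  by_cases ca : D.Adj c a
  · have hcb : IsSingleArc D c b :=
      ⟨h.forward Sca Sab ca hab.1, fun bc => hab.2 (h.forward Sbc Sca bc ca)⟩
    by_cases ac : D.Adj a c
    · exact h.not_isCyclicTriangle_of_isDigon hs ⟨ca, ac⟩ hcb hab hcb' hab' hc.rotate.rotate
    · exact h.not_isCyclicTriangle_of_transitive hs ⟨ca, ac⟩ hab hcb hcb' hc.rotate.rotate
  · have hac : IsSingleArc D a c := ⟨(h.mem_pairs_of_rel hs Sca).resolve_left ca, ca⟩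
    by_cases bc : D.Adj b c
    · by_cases cb : D.Adj c b
      · exact h.reverse.not_isCyclicTriangle_of_isDigon (isSemicomplete_reverse hs) ⟨cb, bc⟩ hab hac
          (mt isFree_reverse_iff.1 hab') (mt isFree_reverse_iff.1 hac') hc.rotate
      · exact h.not_isCyclicTriangle_of_transitive hs hab ⟨bc, cb⟩ hac hac' hc
    · have hcb : IsSingleArc D c b := ⟨(h.mem_pairs_of_rel hs Sbc).resolve_left bc, bc⟩
      exact h.flip.not_isCyclicTriangle_of_transitive hs hac hcb hab hab' hc.flip

theorem not_isCyclicTriangle_isBound (h : IsDigonTransitiveOrientation D S)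
    (hs : D.IsSemicomplete) : ¬ IsCyclicTriangle (IsBound D S) a b c := by
  have isDigon {a b c : V} (hc : IsCyclicTriangle (IsBound D S) a b c) : IsDigon D a b := by
    have hc' : IsCyclicTriangle (IsBound (reverse D) S) a b c :=
      ⟨isBound_reverse_iff.2 hc.rel₁₂, isBound_reverse_iff.2 hc.rel₂₃,
        isBound_reverse_iff.2 hc.rel₃₁⟩
    have hab := h.not_isSingleArc_of_isCyclicTriangle_isBound hs hc
    have hba :=
      h.reverse.not_isSingleArc_of_isCyclicTriangle_isBound (isSemicomplete_reverse hs) hc'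
    rcases h.mem_pairs_of_rel hs hc.rel₁₂.1 with ab | ba
    exacts [⟨ab, not_not.1 fun ba => hab ⟨ab, ba⟩⟩, ⟨not_not.1 fun ab => hba ⟨ba, ab⟩, ba⟩]
  intro hc
  have hca : IsDigon D c a := isDigon hc.rotate.rotate
  exact h.asymm hc.rel₃₁.1
    (h.trans (isDigon hc) (isDigon hc.rotate) hca.symm hc.rel₁₂.1 hc.rel₂₃.1)

end IsDigonTransitiveOrientation

namespace IsForcingOrientation

variable {S : V → V → Prop} {a b c d w : V}

theorem false_of_isFree_diagonals_of_witness (h : IsForcingOrientation D S)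
    (hs : D.IsSemicomplete) (Sab : S a b) (Scd : S c d) (Sda : S d a) (hac : IsFree D a c)
    (hbd : IsFree D b d) (had : IsSingleArc D a d) (hwa : IsDigon D w a) (hdw : IsSingleArc D d w)
    (h₁ : D.Adj a b ∨ ¬ D.Adj d c) (h₂ : D.Adj c d ∨ ¬ D.Adj b a) : False := by
  have wc : D.Adj w c := hac.2.1 w hwa.1
  have hbw : IsSingleArc D b w := ⟨hbd.2.2 w hdw.1, fun wb => hdw.2 (hbd.2.1 w wb)⟩
  have Swa : S w a := (h.swap_iff (Or.inl hwa.2)).2 fun Saw =>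
    h.asymm Sda ((h.rel_iff (hdw.isInducedPath hwa.1 had.1)).1 Saw)
  have Swd : S w d := (h.rel_iff (had.isInducedPath hdw.1 hwa.1)).2 Swa
  have ab : ¬ D.Adj a b := fun ab =>
    h.asymm Swa ((h.rel_iff (hbw.isInducedPath hwa.1 ab)).2 Sab)
  have ba : D.Adj b a := (h.mem_pairs_of_rel hs Sab).resolve_left ab
  have hcd : IsSingleArc D c d := ⟨h₂.resolve_right (not_not.2 ba), h₁.resolve_left ab⟩
  have Scw : S c w := (h.rel_iff (hdw.isInducedPath wc hcd.1)).2 Scd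
  have Swc : S w c := (h.rel_iff (hcd.isInducedPath hdw.1 wc)).1 Swd
  exact h.asymm Scw Swc

theorem false_of_isFree_diagonals_of_isSingleArc (h : IsForcingOrientation D S)
    (hs : D.IsSemicomplete) (Sab : S a b) (Scd : S c d) (Sda : S d a) (hac : IsFree D a c)
    (hbd : IsFree D b d) (had : IsSingleArc D a d) (had' : ¬ IsFree D a d)
    (h₁ : D.Adj a b ∨ ¬ D.Adj d c) (h₂ : D.Adj c d ∨ ¬ D.Adj b a) : False := by
  obtain ⟨w, ⟨hwa, hdw⟩ | ⟨hwd, hwa⟩⟩ := h.exists_witness_of_not_isFree hs had had'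
  · exact h.false_of_isFree_diagonals_of_witness hs Sab Scd Sda hac hbd had hwa hdw h₁ h₂
  · exact h.reverse.flip.false_of_isFree_diagonals_of_witness (isSemicomplete_reverse hs) Scd Sab
      Sda (isFree_reverse_iff.2 hbd) (isFree_reverse_iff.2 hac) had hwd.symm hwa h₂ h₁

theorem false_of_isFree_diagonals (h : IsForcingOrientation D S) (hs : D.IsSemicomplete)
    (hab : IsBound D S a b) (hbc : IsBound D S b c) (hcd : IsBound D S c d)
    (hda : IsBound D S d a) (hac : IsFree D a c) (hbd : IsFree D b d) : False := by
  have of_da (da : ¬ D.Adj d a) (h₁ : D.Adj a b ∨ ¬ D.Adj d c) (h₂ : D.Adj c d ∨ ¬ D.Adj b a) :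
      False :=
    h.false_of_isFree_diagonals_of_isSingleArc hs hab.1 hcd.1 hda.1 hac hbd
      ⟨(h.mem_pairs_of_rel hs hda.1).resolve_left da, da⟩ hda.2.2 h₁ h₂
  have ab_or_ba : D.Adj a b ∨ D.Adj b a := h.mem_pairs_of_rel hs hab.1
  have cd_or_dc : D.Adj c d ∨ D.Adj d c := h.mem_pairs_of_rel hs hcd.1
  by_cases hback : D.Adj b a ∧ D.Adj d c
  · by_cases cb : D.Adj c b
    · have ab : D.Adj a b := hac.2.2 b cb
      have cd : D.Adj c d := hbd.2.1 c cb
      refine of_da (fun da => ?_) (Or.inl ab) (Or.inl cd)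
      exact h.asymm hcd.1 ((h.rel_iff (hac.1.isInducedPath cd da)).2 hda.1)
    · have hbc' : IsSingleArc D b c := ⟨(h.mem_pairs_of_rel hs hbc.1).resolve_right cb, cb⟩
      exact h.flip.false_of_isFree_diagonals_of_isSingleArc hs hab.1 hcd.1 hbc.1 hbd hac hbc'
        hbc.2.1 (Or.inl hback.1) (Or.inl hback.2)
  · refine of_da (fun da => hback ⟨hbd.2.2 a da, hac.2.1 d da⟩) ?_ ?_ <;> tauto

end IsForcingOrientation

/-! ### Cycles of a relation whose non-pairs are comparable -/

section Steps

variable {α : Type*} {r t : α → α → Prop} {k m n : ℕ} {w x y z : α}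

/-- There is an `r`-walk of length `n` from `x` to `y`. -/
inductive Steps (r : α → α → Prop) : ℕ → α → α → Prop
  | refl (x : α) : Steps r 0 x x
  | head {n : ℕ} {x y z : α} : r x y → Steps r n y z → Steps r (n + 1) x z

/-- In every closed `r`-walk of length `k`, any two vertices that split it into two walks of length
at least two are comparable by `t`. -/
def ChordsComparable (r t : α → α → Prop) (k : ℕ) : Prop :=
  ∀ ⦃m n x y⦄, 2 ≤ m → 2 ≤ n → m + n = k → Steps r m x y → Steps r n y x → t x y ∨ t y x

theorem Steps.append (hxy : Steps r m x y) (hyz : Steps r n y z) : Steps r (m + n) x z := by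
  induction hxy with
  | refl x => rwa [Nat.zero_add]
  | head h _ ih =>
    rw [Nat.add_right_comm]
    exact .head h (ih hyz)

theorem Steps.single (h : r x y) : Steps r 1 x y := .head h (.refl y)

theorem exists_steps_of_transGen (h : Relation.TransGen r x y) : ∃ n, Steps r (n + 1) x y := by
  induction h using Relation.TransGen.head_induction_on with
  | single h => exact ⟨0, .single h⟩
  | head h _ ih =>
    obtain ⟨n, hn⟩ := ih
    exact ⟨n + 1, .head h hn⟩

namespace ChordsComparable

theorem rel_of_rel_of_steps [IsTrans α t] (hk : ChordsComparable r t k)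
    (hrt : ∀ {x y}, r x y → ¬ t y x) (hm : 2 ≤ m) (hn : 2 ≤ n) {j : ℕ} (hmk : m + (j + n) = k)
    (hxy : Steps r m x y) (hyz : Steps r j y z) (hzx : Steps r n z x) (ht : t x y) : t x z := by
  induction hyz generalizing m with
  | refl => exact ht
  | @head j y y' z h hyz ih =>
    have hxy' : Steps r (m + 1) x y' := hxy.append (.single h)
    have ht' : t x y' := (hk (by omega) (by omega) (by omega) hxy' (hyz.append hzx)).resolve_right
      fun ht' => hrt h (trans_of t ht' ht)
    exact ih (by omega) (by omega) hxy' hzx ht'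

theorem rel_of_rel_of_head [IsTrans α t] (hk : ChordsComparable r t k)
    (hrt : ∀ {x y}, r x y → ¬ t x y) (hm : 2 ≤ m) (hn : 1 ≤ n) (hmk : m + n + 1 = k)
    (hxy : r x y) (hyz : Steps r m y z) (hzx : Steps r n z x) (ht : t x z) : t y z :=
  (hk hm (by omega) hmk hyz (hzx.append (.single hxy))).resolve_right
    fun ht' => hrt hxy (trans_of t ht ht')

/-- The comparability `t x z` of vertices at distance two is passed on to the next two such pairs,
and from the last of them around the rest of the walk until it is reversed. -/
theorem not_rel_of_rel_of_rel [IsStrictOrder α t] (hk : ChordsComparable r t (n + 5))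
    (hrt : ∀ {x y}, r x y → ¬ t x y ∧ ¬ t y x) (hxy : r x y) (hyz : r y z)
    (hzx : Steps r (n + 3) z x) : ¬ t x z := by
  intro txz
  obtain - | ⟨hzu, hux⟩ := hzx
  rename_i u
  obtain - | ⟨huv, hvx⟩ := hux
  rename_i v
  have hrt₁ {x y : α} (h : r x y) : ¬ t x y := (hrt h).1
  have hrt₂ {x y : α} (h : r x y) : ¬ t y x := (hrt h).2
  have hxz : Steps r 2 x z := .head hxy (.single hyz)
  have hyu : Steps r 2 y u := .head hyz (.single hzu)
  have hzv : Steps r 2 z v := .head hzu (.single huv)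
  have hvy : Steps r (n + 2) v y := hvx.append (.single hxy)
  have txu : t x u := hk.rel_of_rel_of_steps hrt₂ le_rfl (by omega) (by omega) hxz (.single hzu)
    (.head huv hvx) txz
  have tyu : t y u := hk.rel_of_rel_of_head hrt₁ le_rfl (by omega) (by omega) hxy hyu
    (.head huv hvx) txu
  have tyv : t y v := hk.rel_of_rel_of_steps hrt₂ le_rfl (by omega) (by omega) hyu (.single huv)
    hvy tyu
  have tzv : t z v := hk.rel_of_rel_of_head hrt₁ le_rfl (by omega) (by omega) hyz hzv hvy tyv
  have tzx : t z x := hk.rel_of_rel_of_steps hrt₂ le_rfl le_rfl (by omega) hzv hvx hxz tzv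
  exact asymm_of t txz tzx

theorem not_steps_self [IsStrictOrder α t] (hk : ChordsComparable r t (n + 5))
    (hrt : ∀ {x y}, r x y → ¬ t x y ∧ ¬ t y x) : ¬ Steps r (n + 5) x x := by
  intro h
  obtain - | ⟨hxy, hyx⟩ := h
  obtain - | ⟨hyz, hzx⟩ := hyx
  rcases hk le_rfl (by omega) (by omega) (.head hxy (.single hyz)) hzx with txz | tzx
  · exact hk.not_rel_of_rel_of_rel hrt hxy hyz hzx txz
  · have : IsStrictOrder α (flip t) := inferInstanceAs (IsStrictOrder α (Function.swap t))
    have hk' : ChordsComparable r (flip t) (n + 5) :=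
      fun _ _ _ _ hm hn hmn h h' => (hk hm hn hmn h h').symm
    exact hk'.not_rel_of_rel_of_rel (fun h => (hrt h).symm) hxy hyz hzx tzx

end ChordsComparable

theorem chordsComparable_of_minimal (hcover : ∀ {x y}, x ≠ y → r x y ∨ r y x ∨ t x y ∨ t y x)
    (hmin : ∀ m < k, 0 < m → ∀ x, ¬ Steps r m x x) : ChordsComparable r t k := by
  intro m n x y hm hn hmn hxy hyx
  have hne : x ≠ y := by
    rintro rfl
    exact hmin m (by omega) (by omega) x hxy
  rcases hcover hne with h | h | h
  · exact absurd (Steps.head h hyx) (hmin _ (by omega) (by omega) x)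
  · exact absurd (Steps.head h hxy) (hmin _ (by omega) (by omega) y)
  · exact h

theorem not_transGen_self_of_cover [IsStrictOrder α t] (hasymm : ∀ {x y}, r x y → ¬ r y x)
    (hrt : ∀ {x y}, r x y → ¬ t x y ∧ ¬ t y x)
    (hcover : ∀ {x y}, x ≠ y → r x y ∨ r y x ∨ t x y ∨ t y x)
    (h₃ : ∀ {a b c}, r a b → r b c → ¬ r c a)
    (h₄ : ∀ {a b c d}, r a b → r b c → r c d → r d a → t a c → ¬ t b d) (x : α) :
    ¬ Relation.TransGen r x x := by
  suffices ∀ k, 0 < k → ∀ x, ¬ Steps r k x x by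
    intro h
    obtain ⟨n, hn⟩ := exists_steps_of_transGen h
    exact this _ n.succ_pos x hn
  intro k
  induction k using Nat.strong_induction_on with
  | _ k ih =>
  intro hk a h
  have hchords : ChordsComparable r t k := chordsComparable_of_minimal hcover ih
  match k, h with
  | 1, .head haa (.refl _) => exact hasymm haa haa
  | 2, .head hab (.head hba (.refl _)) => exact hasymm hab hba
  | 3, .head hab (.head hbc (.head hca (.refl _))) => exact h₃ hab hbc hca
  | 4, .head hab (.head hbc (.head hcd (.head hda (.refl _)))) =>
    have hac := hchords le_rfl le_rfl rfl (.head hab (.single hbc)) (.head hcd (.single hda))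
    have hbd := hchords le_rfl le_rfl rfl (.head hbc (.single hcd)) (.head hda (.single hab))
    rcases hac with hac | hca <;> rcases hbd with hbd | hdb
    · exact h₄ hab hbc hcd hda hac hbd
    · exact h₄ hda hab hbc hcd hdb hac
    · exact h₄ hbc hcd hda hab hbd hca
    · exact h₄ hcd hda hab hbc hca hdb
  | n + 5, h => exact hchords.not_steps_self hrt h

theorem exists_isStrictTotalOrder_of_not_transGen_self
    (h : ∀ x, ¬ Relation.TransGen r x x) : ∃ s, IsStrictTotalOrder α s ∧ r ≤ s := by
  have : IsStrictOrder α (Relation.TransGen r) := { irrefl := h }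
  let _ : PartialOrder α := partialOrderOfSO (Relation.TransGen r)
  have hmono : StrictMono (toLinearExtension : α →o LinearExtension α) :=
    toLinearExtension.monotone.strictMono_of_injective fun _ _ => id
  exact ⟨fun x y => toLinearExtension x < toLinearExtension y,
    inferInstanceAs (IsStrictTotalOrder (LinearExtension α) (· < ·)),
    fun _ _ hxy => hmono (Relation.TransGen.single hxy)⟩

end Steps

/-! ### Comparability orderings -/

theorem IsInducedPath.not_isFree {a b c : V} (h : IsInducedPath D a b c) :
    (¬ IsFree D a b ∧ ¬ IsFree D b a) ∧ ¬ IsFree D b c ∧ ¬ IsFree D c b := by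
  obtain ⟨-, ab, bc, ac⟩ := h
  exact ⟨⟨fun h => ac (h.2.2 c bc), fun h => h.1.2 ab⟩, fun h => ac (h.2.1 a ab), fun h => h.1.2 bc⟩

namespace IsDigonTransitiveOrientation

variable {S : V → V → Prop}

theorem not_transGen_isBound_self (h : IsDigonTransitiveOrientation D S) (hs : D.IsSemicomplete)
    (x : V) : ¬ Relation.TransGen (IsBound D S) x x := by
  have : IsStrictOrder V (IsFree D) :=
    { irrefl := IsFree.irrefl, trans := fun _ _ _ => IsFree.trans }
  refine not_transGen_self_of_cover (r := IsBound D S) (t := IsFree D)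
    (fun hxy hyx => h.asymm hxy.1 hyx.1) (fun hxy => hxy.2) (fun {x y} hne => ?_)
    (fun hab hbc hca => h.not_isCyclicTriangle_isBound hs ⟨hab, hbc, hca⟩)
    (h.false_of_isFree_diagonals hs) x
  have hxy := h.total (hs x y hne)
  unfold IsBound
  tauto

theorem isComparability (h : IsDigonTransitiveOrientation D S) (hs : D.IsSemicomplete) :
    D.IsComparability := by
  obtain ⟨s, hs', hle⟩ :=
    exists_isStrictTotalOrder_of_not_transGen_self (h.not_transGen_isBound_self hs)
  have rel_iff {x y : V} (hxy : (x, y) ∈ D.pairs) (hfree : ¬ IsFree D x y ∧ ¬ IsFree D y x) :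
      s x y ↔ S x y := by
    refine ⟨fun hsxy => ?_, fun hSxy => hle _ _ ⟨hSxy, hfree⟩⟩
    exact (h.total hxy).resolve_right fun hSyx => asymm_of s hsxy (hle _ _ ⟨hSyx, hfree.symm⟩)
  refine ⟨s, (isComparabilityOrdering_iff h.loopless).2 ⟨hs', fun hxy => ?_, asymm_of s, ?_⟩⟩
  · exact (trichotomous_of s _ _).imp_right (Or.resolve_left · (ne_of_mem_pairs h.loopless hxy))
  · intro a b c hp
    rw [rel_iff (Or.inr hp.2.1) hp.not_isFree.1.symm, rel_iff (Or.inl hp.2.2.1) hp.not_isFree.2]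
    exact h.rel_iff hp

end IsDigonTransitiveOrientation

end ComparabilityDigraph

open ComparabilityDigraph

theorem mainTheorem1_general {V : Type*} (D : Digraph V)
    (hloop : D.IsLoopless) (hD : D.IsSemicomplete) :
    List.TFAE
      [D.IsComparability,
       (D.knottingGraph hloop).IsBipartite,
       ¬ ∃ (p : ℕ) (x : ℕ → V), Odd p ∧ D.IsClosedKnottingWalk p x,
       ∀ I ∈ D.implicationClasses, I ≠ inversePairs I,
       ∀ I ∈ D.implicationClasses, ¬ ContainsCircuit I] := by
  rw [forall_ne_inversePairs_iff, exists_odd_isClosedKnottingWalk_iff]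
  tfae_have 1 → 2 := fun ⟨_, hr⟩ =>
    isBipartite_of_isForcingOrientation hloop ((isComparabilityOrdering_iff hloop).1 hr).2
  tfae_have 2 → 4 := fun h =>
    have ⟨_, hS⟩ := exists_isForcingOrientation_of_isBipartite hloop h
    hS.not_forces_swap
  tfae_have 3 ↔ 4 := by simp only [not_exists]
  tfae_have 4 → 1 := fun h =>
    have ⟨_, hS⟩ := exists_isDigonTransitiveOrientation hloop hD h
    hS.isComparability hD
  tfae_have 1 → 5 := fun ⟨_, hr⟩ _ hI =>
    have ⟨_, hS⟩ := (isComparabilityOrdering_iff hloop).1 hr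
    not_containsCircuit_of_isForcingOrientation hS hI
  tfae_have 5 → 4 := not_forces_swap_of_forall_not_containsCircuit
  tfae_finish

theorem mainTheorem1 {V : Type*} [Finite V] (D : Digraph V)
    (hloop : D.IsLoopless) (hD : D.IsSemicomplete) :
    List.TFAE
      [D.IsComparability,
       (D.knottingGraph hloop).IsBipartite,
       ¬ ∃ (p : ℕ) (x : ℕ → V), Odd p ∧ D.IsClosedKnottingWalk p x,
       ∀ I ∈ D.implicationClasses, I ≠ inversePairs I,
       ∀ I ∈ D.implicationClasses, ¬ ContainsCircuit I] :=
  mainTheorem1_general D hloop hD
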